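/- Let $n\ge 0$ and let $F(x):=f(x)+\delta_C(x)+\sum_{i=1}^n\phi(|x_i|)$ on $\mathbb R^n$ with the Euclidean norm, where $f:\mathbb R^n\to\mathbb R$ is differentiable and convex and $\nabla f$ is Lipschitz continuous with constant $L>0$; $C\subseteq\mathbb R^n$ is nonempty, closed and convex, with indicator function $\delta_C$ ($0$ on $C$, $+\infty$ off $C$); $\phi:[0,\infty)\to[0,\infty)$ is continuous and concave, $\phi(0)=0$, $\phi$ is continuously differentiable on $(0,\infty)$, and $\lim_{t\downarrow0}\phi'(t)$ exists in $\mathbb R$; and $F$ is level-bounded, i.e. $\{x: F(x)\le\alpha\}$ is bounded for every $\alpha\in\mathbb R$. Let $\phi'_+$ denote the right-hand derivative of $\phi$. For a proper function $h$ on a Euclidean space (values in $(-\infty,\infty]$, finite somewhere) and $x$ with $h(x)<\infty$, the regular subdifferential is $$\hat\partial h(x)=\Big\{\zeta:\ \liminf_{z\to x,\,z\ne x}\frac{h(z)-h(x)-\langle\zeta,z-x\rangle}{\|z-x\|}\ge0\Big\},$$ and the limiting subdifferential $\partial h(x)$ is the set of all limits of sequences $\zeta^k\in\hat\partial h(x^k)$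 with $x^k\to x$ and $h(x^k)\to h(x)$; both are empty where $h=\infty$. A proper lower semicontinuous $h$ is a KL function if for every $\hat x$ with $\partial h(\hat x)\neq\emptyset$ there are $a\in(0,\infty]$, a neighborhood $V$ of $\hat x$ and a continuous concave $\varphi:[0,a)\to[0,\infty)$ with $\varphi(0)=0$ that is continuously differentiable on $(0,a)$ with $\varphi'>0$, such that $$\varphi'(h(x)-h(\hat x))\,\mathrm{dist}(0,\partial h(x))\ge1\quad\text{for all }x\in V\text{ with }h(\hat x)<h(x)<h(\hat x)+a,$$ where $\mathrm{dist}(0,\emptyset)=\infty$. A point $\bar x$ is stationary for $\min F$ if $0\in\partial F(\bar x)$. Let $\{\beta_k\}_{k\ge0}\subset[0,1)$, $x^{-1}=x^0\in C$, and let $\{x^k\}$ be generated by the iteratively reweighted $\ell_1$ algorithm with type-I extrapolation (IRL$_1e_1$): for $k\ge0$, $$s_i^{k+1}=\phi'_+(|x_i^k|)\ (1\le i\le n),\qquad y^k=x^k+\beta_k(x^k-x^{k-1}),$$ $$x^{k+1}=\operatorname*{arg\,min}_{u\in C}\Big\{\langle\nabla f(y^k),u-y^k\rangle+\frac L2\|u-y^k\|^2+\sum_{i=1}^n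 s_i^{k+1}|u_i|\Big\}.$$ Assume that $\sup_{k\ge0}\beta_k<1$, that $\phi'_+$ is Lipschitz continuous on $[0,\infty)$, and that $H_1(x,y):=F(x)+\frac L2\|x-y\|^2$ is a KL function on $\mathbb R^n\times\mathbb R^n$. Then $\sum_{k=1}^\infty\|x^k-x^{k-1}\|<\infty$, and $\{x^k\}$ converges to a stationary point of $\min F$. -/

import Mathlib

open Filter Topology Set
open scoped NNReal ENNReal

noncomputable section

namespace IRL

/-! ### Variational analysis of extended-real-valued functions -/

section Subdifferential

variable {X : Type*} [NormedAddCommGroup X] [InnerProductSpace ℝ X]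

/-- A function with values in `(-∞, ∞]` that is finite somewhere. -/
def IsProper (h : X → EReal) : Prop :=
  (∀ x, h x ≠ ⊥) ∧ ∃ x, h x < ⊤

/-- The regular (Fréchet) subdifferential, empty outside the domain of `h`. The limit inferior is
taken in `[-∞, ∞]`. -/
def regularSubdifferential (h : X → EReal) (x : X) : Set X :=
  {ζ | h x < ⊤ ∧
    0 ≤ liminf (fun z : X => (h z - h x - ((inner ℝ ζ (z - x) : ℝ) : EReal)) /
      ((‖z - x‖ : ℝ) : EReal)) (𝓝[≠] x)}

/-- The limiting subdifferential, empty outside the domain of `h`. -/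
def limitingSubdifferential (h : X → EReal) (x : X) : Set X :=
  {ζ | h x < ⊤ ∧ ∃ (u : ℕ → X) (ξ : ℕ → X),
    Tendsto u atTop (𝓝 x) ∧ Tendsto (fun k => h (u k)) atTop (𝓝 (h x)) ∧
    Tendsto ξ atTop (𝓝 ζ) ∧ ∀ k, ξ k ∈ regularSubdifferential h (u k)}

/-- The class `Ξ_a`, for `a ∈ (0, ∞]`, of concave continuous functions `[0, a) → [0, ∞)` that vanish
at `0` and are continuously differentiable with positive derivative on `(0, a)`. Only the values of
`φ` on `[0, a)` matter. -/
structure IsDesingularizing (a : EReal) (φ : ℝ → ℝ) : Prop where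
  map_zero : φ 0 = 0
  nonneg : ∀ t : ℝ, 0 ≤ t → (t : EReal) < a → 0 ≤ φ t
  concaveOn : ConcaveOn ℝ {t : ℝ | 0 ≤ t ∧ (t : EReal) < a} φ
  continuousOn : ContinuousOn φ {t : ℝ | 0 ≤ t ∧ (t : EReal) < a}
  differentiableOn : DifferentiableOn ℝ φ {t : ℝ | 0 < t ∧ (t : EReal) < a}
  continuousOn_deriv : ContinuousOn (deriv φ) {t : ℝ | 0 < t ∧ (t : EReal) < a}
  deriv_pos : ∀ t : ℝ, 0 < t → (t : EReal) < a → 0 < deriv φ t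

/-- The Kurdyka-Łojasiewicz inequality around `p`. The distance is `[0, ∞]`-valued, so that the
distance to an empty subdifferential is `∞`. -/
def HasKLPropertyAt (h : X → EReal) (p : X) : Prop :=
  ∃ a : EReal, 0 < a ∧ ∃ V ∈ 𝓝 p, ∃ φ : ℝ → ℝ, IsDesingularizing a φ ∧
    ∀ x ∈ V, h p < h x → h x < h p + a →
      1 ≤ ENNReal.ofReal (deriv φ (h x - h p).toReal) *
        Metric.infEDist (0 : X) (limitingSubdifferential h x)

/-- A KL function: a proper closed (that is, lower semicontinuous) function with the KL property at
every point at which its limiting subdifferential is non-empty. -/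
def IsKLFunction (h : X → EReal) : Prop :=
  IsProper h ∧ LowerSemicontinuous h ∧
    ∀ p, (limitingSubdifferential h p).Nonempty → HasKLPropertyAt h p

end Subdifferential

/-! ### The optimization problem -/

/-- The indicator function `δ_C`. -/
def indicatorFun {X : Type*} (C : Set X) (x : X) : EReal :=
  open Classical in if x ∈ C then 0 else ⊤

/-- The right-hand derivative `ϕ'₊(t)`. -/
def rightDeriv (ϕ : ℝ → ℝ) (t : ℝ) : ℝ :=
  derivWithin ϕ (Ioi t) t

variable {n : ℕ}

/-- The regularizer `Φ(|x|) = ∑ i, ϕ(|x_i|)`. -/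
def regularizer (ϕ : ℝ → ℝ) (x : EuclideanSpace ℝ (Fin n)) : ℝ :=
  ∑ i, ϕ |x i|

/-- The objective `F(x) = f(x) + δ_C(x) + Φ(|x|)`. -/
def objective (f : EuclideanSpace ℝ (Fin n) → ℝ) (C : Set (EuclideanSpace ℝ (Fin n)))
    (ϕ : ℝ → ℝ) (x : EuclideanSpace ℝ (Fin n)) : EReal :=
  (f x : EReal) + indicatorFun C x + (regularizer ϕ x : EReal)

/-- Level-boundedness: all sublevel sets are bounded. -/
def LevelBounded {X : Type*} [Bornology X] (h : X → EReal) : Prop :=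
  ∀ α : ℝ, Bornology.IsBounded {x | h x ≤ (α : EReal)}

/-- The potential function `H₁(x, y) = f(x) + δ_C(x) + Φ(|x|) + (L/2)‖x - y‖²` on `ℝⁿ × ℝⁿ` with its
Euclidean structure. -/
def potential (f : EuclideanSpace ℝ (Fin n) → ℝ) (C : Set (EuclideanSpace ℝ (Fin n)))
    (ϕ : ℝ → ℝ) (L : ℝ≥0)
    (p : WithLp 2 (EuclideanSpace ℝ (Fin n) × EuclideanSpace ℝ (Fin n))) : EReal :=
  objective f C ϕ p.fst + (((L : ℝ) / 2 * ‖p.fst - p.snd‖ ^ 2 : ℝ) : EReal)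

/-- A stationary point of the problem: `0 ∈ ∂F(x)`. -/
def IsStationary (f : EuclideanSpace ℝ (Fin n) → ℝ) (C : Set (EuclideanSpace ℝ (Fin n)))
    (ϕ : ℝ → ℝ) (x : EuclideanSpace ℝ (Fin n)) : Prop :=
  0 ∈ limitingSubdifferential (objective f C ϕ) x

/-! ### The algorithm -/

/-- The iterate `x^{k-1}`, with the convention `x^{-1} = x^0`. -/
def prevIterate {X : Type*} (x : ℕ → X) : ℕ → X
  | 0 => x 0
  | k + 1 => x k

/-- `x` is a sequence of iterates of the iteratively reweighted `ℓ₁` algorithm with type-I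
extrapolation, with weights `s^{k+1}` (here `s (k + 1)`) and extrapolated points `y^k`. -/
structure IsIterates (f : EuclideanSpace ℝ (Fin n) → ℝ) (C : Set (EuclideanSpace ℝ (Fin n)))
    (ϕ : ℝ → ℝ) (L : ℝ≥0) (β : ℕ → ℝ) (x y s : ℕ → EuclideanSpace ℝ (Fin n)) : Prop where
  init_mem : x 0 ∈ C
  beta_mem : ∀ k, β k ∈ Ico (0 : ℝ) 1
  weights : ∀ k i, s (k + 1) i = rightDeriv ϕ |x k i|
  extrapolation : ∀ k, y k = x k + β k • (x k - prevIterate x k)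
  step_mem : ∀ k, x (k + 1) ∈ C
  step_isMinOn : ∀ k, IsMinOn (fun u : EuclideanSpace ℝ (Fin n) =>
    inner ℝ (gradient f (y k)) (u - y k) + (L : ℝ) / 2 * ‖u - y k‖ ^ 2
      + ∑ i, s (k + 1) i * |u i|) C (x (k + 1))

end IRL

end

/-!
The energy `e k = F (x (k + 1)) + (L / 2) ‖x (k + 1) - x k‖ ^ 2` is the value of the potential at
the pair of the two latest iterates, `F` being the objective. Sufficient descent of this energy, a
bound on its slope by the latest steps and the Kurdyka-Łojasiewicz inequality give convergence.

*Descent.* The subproblem is `L`-strongly convex, `f` lies between its tangent planes and their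
quadratic majorants, and by concavity the weighted `ℓ₁` norm majorizes the penalty up to a
constant. Hence (`objective_descent`) each step loses at least `(L / 2) (1 - β²) ‖x k - x (k - 1)‖²`
of energy, and `sup β < 1` keeps this factor away from `0`. Level-boundedness gives a cluster point
`p`, and the energies decrease to `F p`.

*Slope.* By concavity the right-hand derivative `ϕ'₊` of the penalty is a supergradient; used at
the far end of a segment and combined with the Lipschitz bound on `ϕ'₊`, it also yields a lower
first-order model with a quadratic error (`add_rightDeriv_mul_sub_sq_le`). The optimality
condition of the subproblem involves the frozen weights `ϕ'₊ |x k i|` instead of `ϕ'₊ |x (k + 1)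
i|`. At a nonzero coordinate the absolute value is locally linear and the discrepancy is a linear
term of size at most `ρ |x (k + 1) i - x k i|`. At a zero coordinate `ϕ'₊ 0` dominates every
weight, `ϕ'₊` being antitone, so the inequality goes in the favourable direction and no correction
is needed (`eventually_penalty_abs_ge`). This gives explicit proximal subgradients of the
objective and of the potential (`eventually_objective_ge`, `mem_regularSubdifferential_potential`)
whose norm is bounded by a multiple of the two latest step lengths (`norm_stepSubgradient_le`).

*Finite length.* As the subgradients tend to `0`, the pair `(p, p)` is critical for the potential,
and the Kurdyka-Łojasiewicz inequality holds around it. With concavity of the desingularizing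
function it bounds each step by the previous step and the decrease of the desingularized energy
(`three_mul_le_of_desingularizing`); summing up, the path is too short to leave the neighborhood
(`summable_norm_sub_of_local_energy`). So the sequence has finite length and converges to `p`, and
`0 ∈ ∂F(p)` follows because the step subgradients tend to `0`.
-/

namespace IRL

/-! ### Regular subgradients from local quadratic minorants -/

section Subgradient

variable {X : Type*} [NormedAddCommGroup X] [InnerProductSpace ℝ X]

/-- A proximal subgradient is a regular subgradient: the difference quotient at `z` is at least
`-ρ‖z - x‖`, which tends to `0`. -/
theorem mem_regularSubdifferential_of_eventually_le {h : X → EReal} {x ζ : X} {r ρ : ℝ}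
    (hr : h x = r)
    (hle : ∀ᶠ z in 𝓝 x, ((r + inner ℝ ζ (z - x) - ρ * ‖z - x‖ ^ 2 : ℝ) : EReal) ≤ h z) :
    ζ ∈ regularSubdifferential h x := by
  refine ⟨hr ▸ EReal.coe_lt_top r, le_of_forall_lt fun c hc => ?_⟩
  obtain ⟨c', hcc', hc'⟩ := EReal.lt_iff_exists_real_btwn.1 hc
  refine hcc'.trans_le (le_liminf_of_le (by isBoundedDefault) ?_)
  have hc'' : c' < 0 := by exact_mod_cast hc'
  have hsmall : ∀ᶠ z in 𝓝 x, c' < -(ρ * ‖z - x‖) := by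
    have : Tendsto (fun z : X => -(ρ * ‖z - x‖)) (𝓝 x) (𝓝 (-(ρ * ‖x - x‖))) :=
      (by fun_prop : Continuous fun z : X => -(ρ * ‖z - x‖)).tendsto x
    exact this.eventually (lt_mem_nhds (by simpa using hc''))
  filter_upwards [nhdsWithin_le_nhds hle, nhdsWithin_le_nhds hsmall, self_mem_nhdsWithin]
    with z hz hzs hzx
  have hpos : 0 < ‖z - x‖ := norm_pos_iff.2 (sub_ne_zero.2 hzx)
  rw [EReal.le_div_iff_mul_le (by exact_mod_cast hpos) (EReal.coe_ne_top _), hr]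
  generalize h z = v at hz
  induction v with
  | bot => exact absurd (le_bot_iff.1 hz) (EReal.coe_ne_bot _)
  | top => simp
  | coe v =>
    norm_cast at hz ⊢
    nlinarith [mul_lt_mul_of_pos_right hzs hpos]

theorem regularSubdifferential_subset_limitingSubdifferential (h : X → EReal) (x : X) :
    regularSubdifferential h x ⊆ limitingSubdifferential h x := fun ζ hζ =>
  ⟨hζ.1, fun _ => x, fun _ => ζ, tendsto_const_nhds, tendsto_const_nhds, tendsto_const_nhds,
    fun _ => hζ⟩

end Subgradient

/-! ### Smooth convex functions -/

section Smooth

variable {X : Type*} [NormedAddCommGroup X] [InnerProductSpace ℝ X] [CompleteSpace X]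

theorem hasDerivAt_comp_segment {f : X → ℝ} (hf : Differentiable ℝ f) (x d : X) (t : ℝ) :
    HasDerivAt (fun t : ℝ => f (x + t • d)) (inner ℝ (gradient f (x + t • d)) d) t := by
  have h1 : HasDerivAt (fun t : ℝ => x + t • d) d t := by
    simpa using ((hasDerivAt_id t).smul_const d).const_add x
  have h2 := (hf (x + t • d)).hasGradientAt.hasFDerivAt.comp_hasDerivAt t h1
  rwa [InnerProductSpace.toDual_apply_apply] at h2

/-- A convex differentiable function lies above its tangent planes. -/
theorem convexOn_add_inner_gradient_le {f : X → ℝ} (hf : Differentiable ℝ f)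
    (hc : ConvexOn ℝ univ f) (x u : X) : f x + inner ℝ (gradient f x) (u - x) ≤ f u := by
  have hconv : ConvexOn ℝ univ (fun t : ℝ => f (x + t • (u - x))) := by
    have := hc.comp_affineMap (AffineMap.lineMap x u)
    refine this.congr fun t _ => ?_
    simp [AffineMap.lineMap_apply, add_comm]
  have hd := hasDerivAt_comp_segment hf x (u - x) 0
  have := hconv.le_slope_of_hasDerivAt (mem_univ 0) (mem_univ 1) one_pos hd
  rw [slope_def_field] at this
  simp only [zero_smul, one_smul, add_zero, sub_zero, div_one, add_sub_cancel] at this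
  linarith

/-- The descent lemma: a function with `L`-Lipschitz gradient lies below the quadratic model with
curvature `L` at each point. -/
theorem le_add_inner_gradient_add_sq {f : X → ℝ} {L : ℝ≥0} (hf : Differentiable ℝ f)
    (hlip : LipschitzWith L (gradient f)) (x u : X) :
    f u ≤ f x + inner ℝ (gradient f x) (u - x) + L / 2 * ‖u - x‖ ^ 2 := by
  set d := u - x with hd
  have hder (t : ℝ) : HasDerivAt
      (fun t : ℝ => f (x + t • d) - t * inner ℝ (gradient f x) d - L / 2 * ‖d‖ ^ 2 * t ^ 2)
      (inner ℝ (gradient f (x + t • d)) d - inner ℝ (gradient f x) d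
        - L / 2 * ‖d‖ ^ 2 * (2 * t)) t := by
    simpa only [id, one_mul, Nat.cast_ofNat, Nat.add_one_sub_one, pow_one] using!
      ((hasDerivAt_comp_segment hf x d t).sub
        ((hasDerivAt_id t).mul_const (inner ℝ (gradient f x) d))).sub
        ((hasDerivAt_pow 2 t).const_mul (L / 2 * ‖d‖ ^ 2))
  have hanti : AntitoneOn
      (fun t : ℝ => f (x + t • d) - t * inner ℝ (gradient f x) d - L / 2 * ‖d‖ ^ 2 * t ^ 2)
      (Icc 0 1) := by
    refine antitoneOn_of_deriv_nonpos (convex_Icc 0 1)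
      (fun t _ => (hder t).continuousAt.continuousWithinAt)
      (fun t _ => (hder t).differentiableAt.differentiableWithinAt) fun t ht => ?_
    rw [interior_Icc] at ht
    rw [(hder t).deriv, ← inner_sub_left]
    have h1 := real_inner_le_norm (gradient f (x + t • d) - gradient f x) d
    have h2 : ‖gradient f (x + t • d) - gradient f x‖ ≤ L * (t * ‖d‖) := by
      have := hlip.norm_sub_le (x + t • d) x
      simpa [norm_smul, abs_of_pos ht.1] using this
    nlinarith [mul_le_mul_of_nonneg_right h2 (norm_nonneg d)]
  have := hanti (left_mem_Icc.2 zero_le_one) (right_mem_Icc.2 zero_le_one) zero_le_one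
  have hxd : x + d = u := by rw [hd, add_sub_cancel]
  simp only [zero_smul, one_smul, add_zero, hxd] at this
  linarith

end Smooth

/-! ### The concave penalty -/

section Penalty

variable {ϕ : ℝ → ℝ}

theorem hasDerivWithinAt_rightDeriv (hϕ_cont : ContinuousOn ϕ (Ici 0))
    (hϕ_diff : DifferentiableOn ℝ ϕ (Ioi 0)) (hϕ_lim : ∃ l : ℝ, Tendsto (deriv ϕ) (𝓝[>] 0) (𝓝 l))
    {t : ℝ} (ht : 0 ≤ t) : HasDerivWithinAt ϕ (rightDeriv ϕ t) (Ioi t) t := by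
  refine DifferentiableWithinAt.hasDerivWithinAt ?_
  rcases ht.eq_or_lt with rfl | ht
  · obtain ⟨l, hl⟩ := hϕ_lim
    exact ((hasDerivWithinAt_Ici_of_tendsto_deriv hϕ_diff
      ((hϕ_cont 0 self_mem_Ici).mono Ioi_subset_Ici_self) self_mem_nhdsWithin
        hl).mono Ioi_subset_Ici_self).differentiableWithinAt
  · exact (hϕ_diff.differentiableAt (Ioi_mem_nhds ht)).differentiableWithinAt

/-- The right-hand derivative is a supergradient of the penalty on `[0, ∞)`. -/
theorem penalty_le_add_rightDeriv_mul (hϕ_cont : ContinuousOn ϕ (Ici 0))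
    (hϕ_conc : ConcaveOn ℝ (Ici 0) ϕ)
    (hϕ_diff : DifferentiableOn ℝ ϕ (Ioi 0)) (hϕ_lim : ∃ l : ℝ, Tendsto (deriv ϕ) (𝓝[>] 0) (𝓝 l))
    {a b : ℝ} (ha : 0 ≤ a) (hb : 0 ≤ b) : ϕ b ≤ ϕ a + rightDeriv ϕ a * (b - a) := by
  have hd := hasDerivWithinAt_rightDeriv hϕ_cont hϕ_diff hϕ_lim ha
  rcases lt_trichotomy a b with hab | rfl | hab
  · have := hϕ_conc.slope_le_of_hasDerivWithinAt_Ioi ha hb hab hd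
    rw [slope_def_field, div_le_iff₀ (sub_pos.2 hab)] at this
    linarith
  · simp
  · have hda := (hϕ_diff.differentiableAt (Ioi_mem_nhds (hb.trans_lt hab))).hasDerivAt
    have := hϕ_conc.le_slope_of_hasDerivAt hb ha hab hda
    rw [hda.hasDerivWithinAt.derivWithin (uniqueDiffWithinAt_Ioi a) |>.symm, slope_def_field,
      le_div_iff₀ (sub_pos.2 hab)] at this
    unfold rightDeriv
    linarith

theorem rightDeriv_antitoneOn
    (hsup : ∀ a b, 0 ≤ a → 0 ≤ b → ϕ b ≤ ϕ a + rightDeriv ϕ a * (b - a)) :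
    AntitoneOn (rightDeriv ϕ) (Ici 0) := by
  intro a ha b hb hab
  rcases hab.eq_or_lt with rfl | hab
  · rfl
  have h1 := hsup a b ha hb
  have h2 := hsup b a hb ha
  by_contra! h
  nlinarith [mul_pos (sub_pos.2 h) (sub_pos.2 hab)]

theorem rightDeriv_nonneg (hϕ_nonneg : ∀ t, 0 ≤ t → 0 ≤ ϕ t)
    (hsup : ∀ a b, 0 ≤ a → 0 ≤ b → ϕ b ≤ ϕ a + rightDeriv ϕ a * (b - a))
    {a : ℝ} (ha : 0 ≤ a) : 0 ≤ rightDeriv ϕ a := by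
  by_contra! h
  -- Far enough to the right, the supergradient line with negative slope drops below zero.
  have hq : 0 ≤ (ϕ a + 1) / -rightDeriv ϕ a :=
    div_nonneg (by linarith [hϕ_nonneg a ha]) (by linarith)
  have h1 := hsup a (a + (ϕ a + 1) / -rightDeriv ϕ a) ha (by linarith)
  have h2 := hϕ_nonneg (a + (ϕ a + 1) / -rightDeriv ϕ a) (by linarith)
  have h3 : rightDeriv ϕ a * ((ϕ a + 1) / -rightDeriv ϕ a) = -(ϕ a + 1) := by
    rw [div_neg, mul_neg, mul_div_cancel₀ _ h.ne]
  rw [add_sub_cancel_left, h3] at h1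
  linarith

/-- The supergradient inequality at `b`, combined with the Lipschitz continuity of the slope, bounds
the penalty from below by its first-order model at `a`. -/
theorem add_rightDeriv_mul_sub_sq_le
    (hsup : ∀ a b, 0 ≤ a → 0 ≤ b → ϕ b ≤ ϕ a + rightDeriv ϕ a * (b - a)) {ρ : ℝ≥0}
    (hlip : LipschitzOnWith ρ (rightDeriv ϕ) (Ici 0)) {a b : ℝ} (ha : 0 ≤ a) (hb : 0 ≤ b) :
    ϕ a + rightDeriv ϕ a * (b - a) - ρ * (b - a) ^ 2 ≤ ϕ b := by
  have h1 := hsup b a hb ha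
  have h2 := hlip.dist_le_mul b hb a ha
  rw [Real.dist_eq, Real.dist_eq] at h2
  have h3 : -(ρ * (b - a) ^ 2) ≤ (rightDeriv ϕ b - rightDeriv ϕ a) * (b - a) := by
    have h4 := mul_le_mul_of_nonneg_right h2 (abs_nonneg (b - a))
    rw [← abs_mul, mul_assoc, ← sq, sq_abs] at h4
    linarith [neg_abs_le ((rightDeriv ϕ b - rightDeriv ϕ a) * (b - a))]
  linarith

/-- Near `a`, the composite penalty `ϕ |·|` lies above a model in which the weight `σ` of the
absolute value may differ from the slope of `ϕ` at `|a|`: away from the kink the difference is a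
linear term, and at `a = 0` the slope dominates every admissible weight. -/
theorem eventually_penalty_abs_ge
    (hsup : ∀ a b, 0 ≤ a → 0 ≤ b → ϕ b ≤ ϕ a + rightDeriv ϕ a * (b - a)) {ρ : ℝ≥0}
    (hlip : LipschitzOnWith ρ (rightDeriv ϕ) (Ici 0)) {σ : ℝ} (hσ : σ ≤ rightDeriv ϕ 0) (a : ℝ) :
    ∀ᶠ t in 𝓝 a, ϕ |a| + σ * (|t| - |a|) + (rightDeriv ϕ |a| - σ) * Real.sign a * (t - a)
      - ρ * (t - a) ^ 2 ≤ ϕ |t| := by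
  have hlower (t : ℝ) : ϕ |a| + rightDeriv ϕ |a| * (|t| - |a|) - ρ * (t - a) ^ 2 ≤ ϕ |t| := by
    have h1 := add_rightDeriv_mul_sub_sq_le hsup hlip (abs_nonneg a) (abs_nonneg t)
    have h2 : (|t| - |a|) ^ 2 ≤ (t - a) ^ 2 := sq_le_sq.2 (abs_abs_sub_abs_le_abs_sub t a)
    nlinarith [mul_le_mul_of_nonneg_left h2 ρ.2]
  rcases lt_trichotomy a 0 with ha | rfl | ha
  · filter_upwards [gt_mem_nhds ha] with t ht
    have := hlower t
    rw [Real.sign_of_neg ha]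
    rw [abs_of_neg ha, abs_of_neg ht] at this ⊢
    linarith
  · refine Eventually.of_forall fun t => ?_
    have := hlower t
    simp only [Real.sign_zero, abs_zero] at this ⊢
    nlinarith [mul_le_mul_of_nonneg_right hσ (abs_nonneg t)]
  · filter_upwards [lt_mem_nhds ha] with t ht
    have := hlower t
    rw [Real.sign_of_pos ha]
    rw [abs_of_pos ha, abs_of_pos ht] at this ⊢
    linarith

end Penalty

/-! ### The objective and the potential -/

section Objective

variable {n : ℕ} {f : EuclideanSpace ℝ (Fin n) → ℝ} {C : Set (EuclideanSpace ℝ (Fin n))}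
  {ϕ : ℝ → ℝ}

theorem objective_of_mem {u : EuclideanSpace ℝ (Fin n)} (hu : u ∈ C) :
    objective f C ϕ u = ((f u + regularizer ϕ u : ℝ) : EReal) := by
  simp [objective, indicatorFun, hu]

theorem le_objective {u : EuclideanSpace ℝ (Fin n)} {r : ℝ}
    (h : u ∈ C → r ≤ f u + regularizer ϕ u) : (r : EReal) ≤ objective f C ϕ u := by
  by_cases hu : u ∈ C
  · rw [objective_of_mem hu]
    exact EReal.coe_le_coe_iff.2 (h hu)
  · simp [objective, indicatorFun, hu]

theorem potential_of_mem {L : ℝ≥0} {u v : EuclideanSpace ℝ (Fin n)} (hu : u ∈ C) :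
    potential f C ϕ L (WithLp.toLp 2 (u, v))
      = ((f u + regularizer ϕ u + L / 2 * ‖u - v‖ ^ 2 : ℝ) : EReal) := by
  rw [potential, WithLp.toLp_fst, WithLp.toLp_snd, objective_of_mem hu, EReal.coe_add _ (_ * _)]

theorem continuous_regularizer (hϕ_cont : ContinuousOn ϕ (Ici 0)) :
    Continuous (regularizer ϕ : EuclideanSpace ℝ (Fin n) → ℝ) := by
  unfold regularizer
  refine continuous_finsetSum _ fun i _ => ?_
  exact hϕ_cont.comp_continuous (by fun_prop) fun x => mem_Ici.2 (abs_nonneg _)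

end Objective

/-! ### One step of the algorithm -/

section Step

variable {n : ℕ} {f : EuclideanSpace ℝ (Fin n) → ℝ} {C : Set (EuclideanSpace ℝ (Fin n))}
  {ϕ : ℝ → ℝ} {L ρ : ℝ≥0}

/-- The first-order optimality condition of the weighted `ℓ₁` subproblem, as a variational
inequality over `C`. -/
theorem variational_inequality_of_isMinOn (hC : Convex ℝ C) {g y z s : EuclideanSpace ℝ (Fin n)}
    {c : ℝ} (hs : ∀ i, 0 ≤ s i) (hz : z ∈ C)
    (hmin : IsMinOn (fun u : EuclideanSpace ℝ (Fin n) =>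
      inner ℝ g (u - y) + c / 2 * ‖u - y‖ ^ 2 + ∑ i, s i * |u i|) C z)
    {u : EuclideanSpace ℝ (Fin n)} (hu : u ∈ C) :
    0 ≤ inner ℝ (g + c • (z - y)) (u - z) + ∑ i, s i * (|u i| - |z i|) := by
  have key (t : ℝ) (ht : 0 < t) (ht1 : t ≤ 1) :
      0 ≤ inner ℝ (g + c • (z - y)) (u - z) + ∑ i, s i * (|u i| - |z i|)
        + t * (c / 2 * ‖u - z‖ ^ 2) := by
    have hmem : z + t • (u - z) ∈ C := hC.add_smul_sub_mem hz hu ⟨ht.le, ht1⟩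
    have h1 := hmin hmem
    simp only [mem_ofPred_eq] at h1
    have h2 : ∑ i, s i * |(z + t • (u - z)) i|
        ≤ ∑ i, s i * |z i| + t * ∑ i, s i * (|u i| - |z i|) := by
      rw [Finset.mul_sum, ← Finset.sum_add_distrib]
      refine Finset.sum_le_sum fun i _ => ?_
      have h3 : |(z + t • (u - z)) i| ≤ (1 - t) * |z i| + t * |u i| := by
        have : (z + t • (u - z)) i = (1 - t) * z i + t * u i := by simp; ring
        rw [this]
        refine (abs_add_le _ _).trans_eq ?_
        rw [abs_mul, abs_mul, abs_of_nonneg (sub_nonneg.2 ht1), abs_of_pos ht]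
      nlinarith [mul_le_mul_of_nonneg_left h3 (hs i)]
    have h4 : z + t • (u - z) - y = (z - y) + t • (u - z) := by abel
    rw [h4, inner_add_right, norm_add_sq_real, inner_smul_right, inner_smul_right, norm_smul,
      Real.norm_eq_abs, abs_of_pos ht] at h1
    rw [inner_add_left, inner_smul_left]
    simp only [conj_trivial]
    refine le_of_mul_le_mul_left ?_ ht
    nlinarith
  have hlim : Tendsto (fun t : ℝ => inner ℝ (g + c • (z - y)) (u - z)
      + ∑ i, s i * (|u i| - |z i|) + t * (c / 2 * ‖u - z‖ ^ 2)) (𝓝[>] 0)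
      (𝓝 (inner ℝ (g + c • (z - y)) (u - z) + ∑ i, s i * (|u i| - |z i|)
        + 0 * (c / 2 * ‖u - z‖ ^ 2))) :=
    ((by fun_prop : Continuous fun t : ℝ => inner ℝ (g + c • (z - y)) (u - z)
      + ∑ i, s i * (|u i| - |z i|) + t * (c / 2 * ‖u - z‖ ^ 2)).tendsto 0).mono_left
        nhdsWithin_le_nhds
  rw [zero_mul, add_zero] at hlim
  refine ge_of_tendsto hlim ?_
  filter_upwards [Ioc_mem_nhdsGT (zero_lt_one' ℝ)] with t ht using key t ht.1 ht.2

/-- Sufficient descent: the objective majorized by its `L`-strongly convex model. Convexity of `f`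
turns the value of the model at the old iterate `x` into the objective there. -/
theorem objective_descent (hf : Differentiable ℝ f) (hf_conv : ConvexOn ℝ univ f)
    (hf_lip : LipschitzWith L (gradient f))
    (hsup : ∀ a b, 0 ≤ a → 0 ≤ b → ϕ b ≤ ϕ a + rightDeriv ϕ a * (b - a))
    {x y z s : EuclideanSpace ℝ (Fin n)} (hs : ∀ i, s i = rightDeriv ϕ |x i|)
    (hvi : 0 ≤ inner ℝ (gradient f y + (L : ℝ) • (z - y)) (x - z)
      + ∑ i, s i * (|x i| - |z i|)) :
    f z + regularizer ϕ z + L / 2 * ‖z - x‖ ^ 2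
      ≤ f x + regularizer ϕ x + L / 2 * ‖x - y‖ ^ 2 := by
  have h1 := le_add_inner_gradient_add_sq hf hf_lip y z
  have h2 := convexOn_add_inner_gradient_le hf hf_conv y x
  have h3 : regularizer ϕ z ≤ regularizer ϕ x - ∑ i, s i * (|x i| - |z i|) := by
    rw [regularizer, regularizer, ← Finset.sum_sub_distrib]
    refine Finset.sum_le_sum fun i _ => ?_
    have := hsup |x i| |z i| (abs_nonneg _) (abs_nonneg _)
    rw [← hs] at this
    linarith
  have h4 : x - y = (z - y) + (x - z) := by abel
  rw [h4, norm_add_sq_real, norm_sub_rev z x]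
  rw [h4, inner_add_right] at h2
  rw [inner_add_left, inner_smul_left, conj_trivial] at hvi
  linarith

/-- The subgradient of the objective at the new iterate `z` produced by the step from `x` with
extrapolated point `y`. The last term corrects the frozen weights; it vanishes at the zero
coordinates of `z`. -/
noncomputable def stepSubgradient (f : EuclideanSpace ℝ (Fin n) → ℝ) (ϕ : ℝ → ℝ) (L : ℝ≥0)
    (x y z : EuclideanSpace ℝ (Fin n)) : EuclideanSpace ℝ (Fin n) :=
  gradient f z - (gradient f y + (L : ℝ) • (z - y)) +
    WithLp.toLp 2 fun i => (rightDeriv ϕ |z i| - rightDeriv ϕ |x i|) * Real.sign (z i)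

theorem norm_stepSubgradient_le (hf_lip : LipschitzWith L (gradient f))
    (hlip : LipschitzOnWith ρ (rightDeriv ϕ) (Ici 0)) (x y z : EuclideanSpace ℝ (Fin n)) :
    ‖stepSubgradient f ϕ L x y z‖ ≤ 2 * L * ‖z - y‖ + ρ * ‖z - x‖ := by
  have h1 : ‖gradient f z - (gradient f y + (L : ℝ) • (z - y))‖ ≤ 2 * L * ‖z - y‖ := by
    rw [← sub_sub]
    refine (norm_sub_le _ _).trans ?_
    have := hf_lip.norm_sub_le z y
    rw [norm_smul, Real.norm_of_nonneg L.coe_nonneg]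
    linarith
  have h2 : ‖(WithLp.toLp 2 fun i => (rightDeriv ϕ |z i| - rightDeriv ϕ |x i|) *
      Real.sign (z i) : EuclideanSpace ℝ (Fin n))‖ ≤ ρ * ‖z - x‖ := by
    refine le_of_sq_le_sq ?_ (by positivity)
    rw [mul_pow, EuclideanSpace.real_norm_sq_eq, EuclideanSpace.real_norm_sq_eq, Finset.mul_sum]
    refine Finset.sum_le_sum fun i _ => ?_
    have h3 := hlip.dist_le_mul |z i| (mem_Ici.2 (abs_nonneg _)) |x i| (mem_Ici.2 (abs_nonneg _))
    rw [Real.dist_eq, Real.dist_eq] at h3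
    have h4 : |Real.sign (z i)| ≤ 1 := by
      rcases Real.sign_apply_eq (z i) with h | h | h <;> simp [h]
    have h5 : |(rightDeriv ϕ |z i| - rightDeriv ϕ |x i|) * Real.sign (z i)|
        ≤ ρ * |z i - x i| := by
      rw [abs_mul]
      calc _ ≤ |rightDeriv ϕ |z i| - rightDeriv ϕ (|x i|)| * 1 := by gcongr
        _ ≤ ρ * |z i - x i| := by
          rw [mul_one]
          exact h3.trans (mul_le_mul_of_nonneg_left (abs_abs_sub_abs_le_abs_sub _ _) ρ.coe_nonneg)
    have h6 := pow_le_pow_left₀ (abs_nonneg _) h5 2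
    rw [sq_abs, mul_pow (ρ : ℝ), sq_abs] at h6
    simpa using h6
  exact (norm_add_le _ _).trans (add_le_add h1 h2)

/-- The step subgradient is a proximal subgradient of the objective. -/
theorem eventually_objective_ge (hf : Differentiable ℝ f) (hf_conv : ConvexOn ℝ univ f)
    (hsup : ∀ a b, 0 ≤ a → 0 ≤ b → ϕ b ≤ ϕ a + rightDeriv ϕ a * (b - a))
    (hlip : LipschitzOnWith ρ (rightDeriv ϕ) (Ici 0))
    {x y z s : EuclideanSpace ℝ (Fin n)} (hs : ∀ i, s i = rightDeriv ϕ |x i|)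
    (hvi : ∀ u ∈ C, 0 ≤ inner ℝ (gradient f y + (L : ℝ) • (z - y)) (u - z)
      + ∑ i, s i * (|u i| - |z i|)) :
    ∀ᶠ u in 𝓝 z, u ∈ C → f z + regularizer ϕ z
      + inner ℝ (stepSubgradient f ϕ L x y z) (u - z) - ρ * ‖u - z‖ ^ 2
        ≤ f u + regularizer ϕ u := by
  have hpen : ∀ᶠ u in 𝓝 z, ∀ i, ϕ |z i| + s i * (|u i| - |z i|)
      + (rightDeriv ϕ |z i| - s i) * Real.sign (z i) * (u i - z i)
      - ρ * (u i - z i) ^ 2 ≤ ϕ |u i| := by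
    refine eventually_all.2 fun i => ?_
    have hσ : s i ≤ rightDeriv ϕ 0 := hs i ▸
      rightDeriv_antitoneOn hsup self_mem_Ici (abs_nonneg (x i)) (abs_nonneg (x i))
    exact ((by fun_prop : Continuous fun u : EuclideanSpace ℝ (Fin n) => u i).tendsto z).eventually
      (eventually_penalty_abs_ge hsup hlip hσ (z i))
  filter_upwards [hpen] with u hu huC
  have h1 := convexOn_add_inner_gradient_le hf hf_conv z u
  have h2 := hvi u huC
  have h3 := Finset.sum_le_sum fun i (_ : i ∈ Finset.univ) => hu i
  rw [Finset.sum_sub_distrib, Finset.sum_add_distrib, Finset.sum_add_distrib, ← Finset.mul_sum]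
    at h3
  have h4 : inner ℝ (WithLp.toLp 2 fun i => (rightDeriv ϕ |z i| - rightDeriv ϕ |x i|) *
      Real.sign (z i) : EuclideanSpace ℝ (Fin n)) (u - z)
      = ∑ i, (rightDeriv ϕ |z i| - s i) * Real.sign (z i) * (u i - z i) := by
    rw [PiLp.inner_apply]
    refine Finset.sum_congr rfl fun i _ => ?_
    simp [hs, mul_comm]
  have h5 : ‖u - z‖ ^ 2 = ∑ i, (u i - z i) ^ 2 := by
    simp [EuclideanSpace.real_norm_sq_eq]
  rw [stepSubgradient, inner_add_left, inner_sub_left, h4, h5]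
  simp only [regularizer]
  linarith

theorem stepSubgradient_mem_regularSubdifferential {x y z : EuclideanSpace ℝ (Fin n)}
    (hz : z ∈ C)
    (hprox : ∀ᶠ u in 𝓝 z, u ∈ C → f z + regularizer ϕ z
      + inner ℝ (stepSubgradient f ϕ L x y z) (u - z) - ρ * ‖u - z‖ ^ 2
        ≤ f u + regularizer ϕ u) :
    stepSubgradient f ϕ L x y z ∈ regularSubdifferential (objective f C ϕ) z :=
  mem_regularSubdifferential_of_eventually_le (objective_of_mem hz)
    (hprox.mono fun _ hu => le_objective hu)

/-- A proximal subgradient of the objective, combined with the gradient of the coupling term, gives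
a regular subgradient of the potential. -/
theorem mem_regularSubdifferential_potential {z v ζ : EuclideanSpace ℝ (Fin n)} {ρ : ℝ}
    (hρ : 0 ≤ ρ) (hz : z ∈ C)
    (hprox : ∀ᶠ u in 𝓝 z, u ∈ C → f z + regularizer ϕ z
      + inner ℝ ζ (u - z) - ρ * ‖u - z‖ ^ 2 ≤ f u + regularizer ϕ u) :
    (WithLp.toLp 2 (ζ + (L : ℝ) • (z - v), -((L : ℝ) • (z - v))) :
      WithLp 2 (EuclideanSpace ℝ (Fin n) × EuclideanSpace ℝ (Fin n)))
        ∈ regularSubdifferential (potential f C ϕ L) (WithLp.toLp 2 (z, v)) := by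
  refine mem_regularSubdifferential_of_eventually_le (ρ := ρ) (potential_of_mem hz) ?_
  have hfst : Tendsto (fun p : WithLp 2 (EuclideanSpace ℝ (Fin n) × EuclideanSpace ℝ (Fin n)) =>
      p.fst) (𝓝 (WithLp.toLp 2 (z, v))) (𝓝 z) :=
    (by fun_prop : Continuous fun p : WithLp 2 (EuclideanSpace ℝ (Fin n) ×
      EuclideanSpace ℝ (Fin n)) => p.fst).tendsto (WithLp.toLp 2 (z, v))
  filter_upwards [hfst.eventually hprox] with p hp
  obtain ⟨u, w⟩ := p
  simp only [WithLp.toLp_fst] at hp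
  by_cases hu : u ∈ C
  · rw [potential_of_mem hu, EReal.coe_le_coe_iff, WithLp.prod_inner_apply,
      WithLp.prod_norm_sq_eq_of_L2]
    simp only [WithLp.sub_fst, WithLp.sub_snd, WithLp.toLp_fst, WithLp.toLp_snd, WithLp.ofLp_sub,
      Prod.fst_sub, Prod.snd_sub]
    have h1 := hp hu
    have h2 : u - w = (z - v) + ((u - z) - (w - v)) := by abel
    rw [h2, norm_add_sq_real, inner_add_left, inner_neg_left, inner_smul_left, inner_smul_left,
      inner_sub_right (z - v) (u - z)]
    simp only [conj_trivial]
    have h3 : 0 ≤ (L : ℝ) / 2 * ‖u - z - (w - v)‖ ^ 2 := by positivity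
    have h4 : 0 ≤ ρ * ‖w - v‖ ^ 2 := by positivity
    linarith
  · have : potential f C ϕ L (WithLp.toLp 2 (u, w)) = ⊤ := by
      simp [potential, objective, indicatorFun, hu, -EReal.coe_mul, -EReal.coe_pow]
    rw [this]
    exact le_top

end Step

/-! ### Finite length under the Kurdyka-Łojasiewicz inequality -/

theorem tendsto_norm_sub_zero_of_descent {X : Type*} [NormedAddCommGroup X] {x : ℕ → X} {e : ℕ → ℝ}
    {e₀ c : ℝ} (hc : 0 < c) (hdesc : ∀ k, e (k + 1) + c * ‖x (k + 1) - x k‖ ^ 2 ≤ e k)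
    (he_lim : Tendsto e atTop (𝓝 e₀)) :
    Tendsto (fun k => ‖x (k + 1) - x k‖) atTop (𝓝 0) := by
  have h1 : Tendsto (fun k => (e k - e (k + 1)) / c) atTop (𝓝 0) := by
    simpa using (he_lim.sub (he_lim.comp (tendsto_add_atTop_nat 1))).div_const c
  have h2 : Tendsto (fun k => ‖x (k + 1) - x k‖ ^ 2) atTop (𝓝 0) :=
    squeeze_zero (fun _ => sq_nonneg _)
      (fun k => (le_div_iff₀ hc).2 (by linarith [hdesc k])) h1
  simpa [Real.sqrt_sq (norm_nonneg _)] using h2.sqrt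

/-- The trapping argument behind convergence under the Kurdyka-Łojasiewicz inequality. Once the
sequence is close to a cluster point and the remaining budget `w` is small, the inequality bounds
the length of the path before it can leave the ball, hence it never leaves and the length is
finite. -/
theorem summable_norm_sub_of_local_energy {X : Type*} [NormedAddCommGroup X]
    {x : ℕ → X} {p : X} {r : ℝ} {w : ℕ → ℝ} (hr : 0 < r) (hw : ∀ᶠ k in atTop, 0 ≤ w k)
    (hw_lim : Tendsto w atTop (𝓝 0)) (hd : Tendsto (fun k => ‖x (k + 1) - x k‖) atTop (𝓝 0))
    (hp : MapClusterPt p atTop x)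
    (henergy : ∀ᶠ k in atTop, dist (x (k + 1)) p < r → dist (x (k + 2)) p < r →
      3 * ‖x (k + 2) - x (k + 1)‖ ≤ ‖x (k + 1) - x k‖ + 4 * (w (k + 1) - w (k + 2))) :
    Summable fun k => ‖x (k + 1) - x k‖ := by
  obtain ⟨K₀, hK₀⟩ := eventually_atTop.1 (hw.and ((hw_lim.eventually (gt_mem_nhds
    (by positivity : 0 < r / 16))).and ((hd.eventually (gt_mem_nhds
    (by positivity : 0 < r / 8))).and henergy)))
  obtain ⟨K₁, hK₁, hball⟩ := frequently_atTop.1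
    (hp.frequently (Metric.ball_mem_nhds p (by positivity : 0 < r / 4))) (K₀ + 1)
  obtain ⟨K, rfl⟩ : ∃ K, K₁ = K + 1 := ⟨K₁ - 1, by omega⟩
  have hK : K₀ ≤ K := by omega
  have key (m : ℕ) :
      2 * ∑ j ∈ Finset.range m, ‖x (K + 1 + j + 1) - x (K + 1 + j)‖ + ‖x (K + m + 1) - x (K + m)‖
        ≤ ‖x (K + 1) - x K‖ + 4 * (w (K + 1) - w (K + m + 1)) ∧
      dist (x (K + m + 1)) p
        ≤ r / 4 + ∑ j ∈ Finset.range m, ‖x (K + 1 + j + 1) - x (K + 1 + j)‖ := by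
    induction m with
    | zero => simpa using hball.le
    | succ m ih =>
      obtain ⟨ih1, ih2⟩ := ih
      have e1 : K + 1 + m = K + m + 1 := by ring
      have e2 : K + (m + 1) = K + m + 1 := by ring
      rw [Finset.sum_range_succ, e1, e2]
      have hwm := (hK₀ (K + m + 1) (by omega)).1
      have hwK := (hK₀ (K + 1) (by omega)).2.1
      have hdK := (hK₀ K hK).2.2.1
      have hdm := (hK₀ (K + m + 1) (by omega)).2.2.1
      have hS := norm_nonneg (x (K + m + 1) - x (K + m))
      have htri : dist (x (K + m + 1 + 1)) p ≤
          ‖x (K + m + 1 + 1) - x (K + m + 1)‖ + dist (x (K + m + 1)) p := by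
        rw [← dist_eq_norm]; exact dist_triangle _ _ _
      refine ⟨?_, by linarith⟩
      have hE := (hK₀ (K + m) (by omega)).2.2.2 (by linarith)
        (by show dist (x (K + m + 1 + 1)) p < r; linarith)
      change 3 * ‖x (K + m + 1 + 1) - x (K + m + 1)‖ ≤
        ‖x (K + m + 1) - x (K + m)‖ + 4 * (w (K + m + 1) - w (K + m + 1 + 1)) at hE
      linarith
  rw [← summable_nat_add_iff (K + 1)]
  refine summable_of_sum_range_le (c := ‖x (K + 1) - x K‖ + 4 * w (K + 1))
    (fun _ => norm_nonneg _) fun m => ?_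
  have hwm := (hK₀ (K + m + 1) (by omega)).1
  have hS := norm_nonneg (x (K + m + 1) - x (K + m))
  have hsum : 0 ≤ ∑ j ∈ Finset.range m, ‖x (K + 1 + j + 1) - x (K + 1 + j)‖ :=
    Finset.sum_nonneg fun _ _ => norm_nonneg _
  have := (key m).1
  have e : ∑ j ∈ Finset.range m, ‖x (j + (K + 1) + 1) - x (j + (K + 1))‖
      = ∑ j ∈ Finset.range m, ‖x (K + 1 + j + 1) - x (K + 1 + j)‖ :=
    Finset.sum_congr rfl fun j _ => by rw [add_comm j]
  rw [e]
  linarith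

/-- One step of the Kurdyka-Łojasiewicz argument: `u` is the current gap of the energy, `v` the
next one, `d'` the current step length and `d` the previous one, `g` bounds the slope. -/
theorem three_mul_le_of_desingularizing {a : EReal} {φ : ℝ → ℝ} (hφ : IsDesingularizing a φ)
    {u v c D d d' g : ℝ} (hv : 0 < v) (hua : (u : EReal) < a) (hc : 0 < c) (hD : 0 < D)
    (hd : 0 ≤ d) (hd' : 0 ≤ d') (hdesc : v + c * d' ^ 2 ≤ u) (hg : g ≤ D * (d' + d))
    (hKL : 1 ≤ deriv φ u * g) :
    3 * d' ≤ d + 4 * (D / c * φ u - D / c * φ v) := by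
  have hvu : v ≤ u := by nlinarith [sq_nonneg d']
  have hu : 0 < u := hv.trans_le hvu
  have hpos := hφ.deriv_pos u hu hua
  have hopen : {t : ℝ | 0 < t ∧ (t : EReal) < a} ∈ 𝓝 u :=
    ((isOpen_Ioi (a := (0 : ℝ))).inter
      (isOpen_Iio.preimage continuous_coe_real_ereal)).mem_nhds ⟨hu, hua⟩
  have hslope : deriv φ u * (u - v) ≤ φ u - φ v := by
    rcases hvu.eq_or_lt with rfl | hlt
    · simp
    have := hφ.concaveOn.le_slope_of_hasDerivAt
      (show v ∈ {t : ℝ | 0 ≤ t ∧ (t : EReal) < a} from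
        ⟨hv.le, (EReal.coe_le_coe_iff.2 hvu).trans_lt hua⟩)
      (show u ∈ {t : ℝ | 0 ≤ t ∧ (t : EReal) < a} from ⟨hu.le, hua⟩) hlt
      (hφ.differentiableOn.differentiableAt hopen).hasDerivAt
    rwa [slope_def_field, le_div_iff₀ (sub_pos.2 hlt)] at this
  set P := deriv φ u
  have h1 : 1 ≤ P * (D * (d' + d)) := hKL.trans (by gcongr)
  set Δ := D / c * φ u - D / c * φ v with hΔ
  have hΔ' : Δ * c = D * (φ u - φ v) := by rw [hΔ]; field_simp
  have h2 : P * (c * d' ^ 2) ≤ φ u - φ v :=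
    le_trans (by gcongr; linarith) hslope
  have hs : 0 ≤ d' + d := by positivity
  have h3 : d' ^ 2 ≤ Δ * (d' + d) := by
    have h4 : d' ^ 2 * c ≤ P * (D * (d' + d)) * (c * d' ^ 2) := by
      nlinarith [mul_le_mul_of_nonneg_right h1 (by positivity : 0 ≤ c * d' ^ 2)]
    have h5 : P * (D * (d' + d)) * (c * d' ^ 2) ≤ Δ * (d' + d) * c := by
      have := mul_le_mul_of_nonneg_left h2 (by positivity : 0 ≤ D * (d' + d))
      calc _ = D * (d' + d) * (P * (c * d' ^ 2)) := by ring
        _ ≤ _ := this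
        _ = (Δ * c) * (d' + d) := by rw [hΔ']; ring
        _ = _ := by ring
    exact le_of_mul_le_mul_right (h4.trans h5) hc
  -- The inequality of arithmetic and geometric means, in the form `√(Δ s) ≤ Δ + s / 4`.
  have hΔ0 : 0 ≤ Δ := by
    have : 0 ≤ φ u - φ v := le_trans (by positivity) h2
    have : 0 ≤ Δ * c := by rw [hΔ']; positivity
    exact nonneg_of_mul_nonneg_left this hc
  have h6 : d' ≤ Δ + (d' + d) / 4 := by
    apply le_of_sq_le_sq _ (by positivity)
    nlinarith [sq_nonneg (Δ - (d' + d) / 4)]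
  linarith

section KL

variable {X : Type*} [NormedAddCommGroup X] [InnerProductSpace ℝ X]

/-- The Kurdyka-Łojasiewicz inequality at a point where a limiting subgradient is known. -/
theorem one_le_deriv_mul_norm {h : X → EReal} {p z ξ : X} {φ : ℝ → ℝ} {e e₀ : ℝ}
    (hz : h z = e) (hp : h p = e₀) (hφ : 0 ≤ deriv φ (e - e₀))
    (hξ : ξ ∈ limitingSubdifferential h z)
    (hKL : 1 ≤ ENNReal.ofReal (deriv φ (h z - h p).toReal) *
      Metric.infEDist (0 : X) (limitingSubdifferential h z)) :
    1 ≤ deriv φ (e - e₀) * ‖ξ‖ := by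
  rw [hz, hp, ← EReal.coe_sub, EReal.toReal_coe] at hKL
  have h1 := hKL.trans (mul_le_mul_right (Metric.infEDist_le_edist_of_mem hξ) _)
  rw [edist_dist, dist_zero_left, ← ENNReal.ofReal_mul hφ] at h1
  simpa using h1

end KL

section Length

variable {n : ℕ}

/-- Finite length of a sequence for which an energy decreases by at least the squared step, with
energy values attained by a Kurdyka-Łojasiewicz potential at consecutive pairs of points, and with
subgradients of the potential bounded by the two latest steps. -/
theorem summable_norm_sub_of_hasKLPropertyAt
    {h : WithLp 2 (EuclideanSpace ℝ (Fin n) × EuclideanSpace ℝ (Fin n)) → EReal}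
    {x : ℕ → EuclideanSpace ℝ (Fin n)} {p : EuclideanSpace ℝ (Fin n)} {e : ℕ → ℝ} {e₀ c D : ℝ}
    (hc : 0 < c) (hD : 0 < D) (hKL : HasKLPropertyAt h (WithLp.toLp 2 (p, p)))
    (hp : h (WithLp.toLp 2 (p, p)) = e₀)
    (he : ∀ k, h (WithLp.toLp 2 (x (k + 1), x k)) = e k)
    (hdesc : ∀ k, e (k + 1) + c * ‖x (k + 1) - x k‖ ^ 2 ≤ e k)
    (he_lim : Tendsto e atTop (𝓝 e₀)) (hclus : MapClusterPt p atTop x)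
    (hsub : ∀ k, ∃ ξ ∈ limitingSubdifferential h (WithLp.toLp 2 (x (k + 2), x (k + 1))),
      ‖ξ‖ ≤ D * (‖x (k + 2) - x (k + 1)‖ + ‖x (k + 1) - x k‖)) :
    Summable fun k => ‖x (k + 1) - x k‖ := by
  have hanti : Antitone e := antitone_nat_of_succ_le fun k =>
    (le_add_of_nonneg_right (by positivity)).trans (hdesc k)
  have hge (k : ℕ) : e₀ ≤ e k := hanti.le_of_tendsto he_lim k
  have hd : Tendsto (fun k => ‖x (k + 1) - x k‖) atTop (𝓝 0) :=
    tendsto_norm_sub_zero_of_descent hc hdesc he_lim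
  by_cases hfin : ∃ k, e k = e₀
  · -- If the limiting energy is attained, all later steps vanish.
    obtain ⟨K, hK⟩ := hfin
    rw [← summable_nat_add_iff K]
    refine summable_zero.congr fun k => ?_
    have h1 : e (k + K) ≤ e₀ := hK ▸ hanti (by omega)
    have h2 := hdesc (k + K)
    have h3 := hge (k + K + 1)
    have h4 : ‖x (k + K + 1) - x (k + K)‖ ^ 2 ≤ 0 := by
      by_contra! h
      linarith [mul_pos hc h]
    exact (pow_eq_zero_iff two_ne_zero).1 (le_antisymm h4 (sq_nonneg _)) |>.symm
  have hgt (k : ℕ) : e₀ < e k := (hge k).lt_of_ne fun h => hfin ⟨k, h.symm⟩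
  obtain ⟨a, ha, V, hV, φ, hφ, hineq⟩ := hKL
  obtain ⟨r, hr, hball⟩ := Metric.mem_nhds_iff.1
    ((WithLp.prod_continuous_toLp 2 (EuclideanSpace ℝ (Fin n))
      (EuclideanSpace ℝ (Fin n))).continuousAt.preimage_mem_nhds hV)
  have hgap : Tendsto (fun k => e k - e₀) atTop (𝓝 0) := by
    simpa using he_lim.sub_const e₀
  have hgap_lt : ∀ᶠ k in atTop, ((e k - e₀ : ℝ) : EReal) < a := by
    have := (continuous_coe_real_ereal.tendsto 0).comp hgap
    exact this.eventually (gt_mem_nhds (by simpa using ha))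
  have hφ_lim : Tendsto (fun k => D / c * φ (e k - e₀)) atTop (𝓝 0) := by
    have h1 : Tendsto (fun k => e k - e₀) atTop
        (𝓝[{t : ℝ | 0 ≤ t ∧ (t : EReal) < a}] 0) :=
      tendsto_nhdsWithin_iff.2 ⟨hgap, hgap_lt.mono fun k hk => ⟨sub_nonneg.2 (hge k), hk⟩⟩
    have h2 := (hφ.continuousOn 0 ⟨le_rfl, by simpa using ha⟩).tendsto.comp h1
    rw [hφ.map_zero] at h2
    simpa using h2.const_mul (D / c)
  refine summable_norm_sub_of_local_energy (w := fun k => D / c * φ (e k - e₀)) hr ?_ hφ_lim hd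
    hclus ?_
  · filter_upwards [hgap_lt] with k hk
    exact mul_nonneg (by positivity) (hφ.nonneg _ (sub_nonneg.2 (hge k)) hk)
  · filter_upwards [(tendsto_add_atTop_nat 1).eventually hgap_lt] with k hk hk1 hk2
    obtain ⟨ξ, hξ, hξD⟩ := hsub k
    refine three_mul_le_of_desingularizing hφ (sub_pos.2 (hgt (k + 2))) hk hc hD
      (norm_nonneg _) (norm_nonneg _) (by linarith [hdesc (k + 1)]) hξD ?_
    refine one_le_deriv_mul_norm (he (k + 1)) hp
      (hφ.deriv_pos _ (sub_pos.2 (hgt (k + 1))) hk).le hξ ?_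
    have hmem : (x (k + 2), x (k + 1)) ∈ Metric.ball (p, p) r := by
      rw [Metric.mem_ball, Prod.dist_eq]
      exact max_lt hk2 hk1
    refine hineq _ (hball hmem) ?_ ?_
    · rw [he (k + 1), hp]
      exact EReal.coe_lt_coe_iff.2 (hgt (k + 1))
    · rw [he (k + 1), hp]
      calc ((e (k + 1) : ℝ) : EReal) = (e₀ : EReal) + ((e (k + 1) - e₀ : ℝ) : EReal) := by
            rw [← EReal.coe_add]; congr 1; ring
        _ < _ := EReal.add_lt_add_left_coe hk e₀

end Length

end IRL

open IRL in
theorem theorem3p4 {n : ℕ}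
    -- the smooth convex loss, with an `L`-Lipschitz gradient
    (f : EuclideanSpace ℝ (Fin n) → ℝ) (L : ℝ≥0) (hL : 0 < L)
    (hf_diff : Differentiable ℝ f) (hf_conv : ConvexOn ℝ univ f)
    (hf_lip : LipschitzWith L (gradient f))
    -- the constraint set
    (C : Set (EuclideanSpace ℝ (Fin n)))
    (hC_ne : C.Nonempty) (hC_closed : IsClosed C) (hC_conv : Convex ℝ C)
    -- the penalty `[0, ∞) → [0, ∞)`; its values at negative numbers play no role
    (ϕ : ℝ → ℝ) (hϕ_nonneg : ∀ t, 0 ≤ t → 0 ≤ ϕ t) (hϕ_zero : ϕ 0 = 0)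
    (hϕ_cont : ContinuousOn ϕ (Ici 0)) (hϕ_conc : ConcaveOn ℝ (Ici 0) ϕ)
    (hϕ_diff : DifferentiableOn ℝ ϕ (Ioi 0)) (hϕ_deriv : ContinuousOn (deriv ϕ) (Ioi 0))
    (hϕ_lim : ∃ l : ℝ, Tendsto (deriv ϕ) (𝓝[>] 0) (𝓝 l))
    (hF : IRL.LevelBounded (IRL.objective f C ϕ))
    -- the iterates
    (β : ℕ → ℝ) (x y s : ℕ → EuclideanSpace ℝ (Fin n))
    (hx : IRL.IsIterates f C ϕ L β x y s)
    -- the additional assumptions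
    (hβ : (⨆ k, β k) < 1)
    (hϕ_lip : ∃ ρ : ℝ≥0, LipschitzOnWith ρ (IRL.rightDeriv ϕ) (Ici 0))
    (hKL : IRL.IsKLFunction (IRL.potential f C ϕ L)) :
    Summable (fun k : ℕ => ‖x (k + 1) - x k‖) ∧
      ∃ xbar : EuclideanSpace ℝ (Fin n),
        Tendsto x atTop (𝓝 xbar) ∧ IRL.IsStationary f C ϕ xbar := by
  obtain ⟨ρ, hlip⟩ := hϕ_lip
  have hL' : (0 : ℝ) < L := hL
  have hsup (a b : ℝ) (ha : 0 ≤ a) (hb : 0 ≤ b) : ϕ b ≤ ϕ a + rightDeriv ϕ a * (b - a) :=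
    penalty_le_add_rightDeriv_mul hϕ_cont hϕ_conc hϕ_diff hϕ_lim ha hb
  have hmem (k : ℕ) : x k ∈ C := by
    cases k with
    | zero => exact hx.init_mem
    | succ k => exact hx.step_mem k
  have hvi (k : ℕ) : ∀ u ∈ C, 0 ≤ inner ℝ (gradient f (y k) + (L : ℝ) • (x (k + 1) - y k))
      (u - x (k + 1)) + ∑ i, s (k + 1) i * (|u i| - |x (k + 1) i|) := fun u hu =>
    variational_inequality_of_isMinOn hC_conv
      (fun i => hx.weights k i ▸ rightDeriv_nonneg hϕ_nonneg hsup (abs_nonneg _))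
      (hx.step_mem k) (hx.step_isMinOn k) hu
  set G : EuclideanSpace ℝ (Fin n) → ℝ := fun u => f u + regularizer ϕ u with hG
  have hG_cont : Continuous G := hf_diff.continuous.add (continuous_regularizer hϕ_cont)
  -- The energy of the pair of iterates `(x (k + 1), x k)`.
  set e : ℕ → ℝ := fun k => G (x (k + 1)) + L / 2 * ‖x (k + 1) - x k‖ ^ 2 with he
  have he_pot (k : ℕ) : potential f C ϕ L (WithLp.toLp 2 (x (k + 1), x k)) = e k :=
    potential_of_mem (hmem _)
  set b := ⨆ k, β k
  have hβ_le (k : ℕ) : β k ≤ b :=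
    le_ciSup (f := β) ⟨1, by rintro _ ⟨k, rfl⟩; exact (hx.beta_mem k).2.le⟩ k
  have hb0 : 0 ≤ b := (hx.beta_mem 0).1.trans (hβ_le 0)
  have hy (k : ℕ) : ‖x (k + 1) - y (k + 1)‖ = β (k + 1) * ‖x (k + 1) - x k‖ := by
    rw [hx.extrapolation, prevIterate, sub_add_cancel_left, norm_neg, norm_smul,
      Real.norm_of_nonneg (hx.beta_mem _).1]
  set c : ℝ := L / 2 * (1 - b ^ 2) with hc_def
  have hc : 0 < c := mul_pos (by positivity) (by nlinarith)
  have hdesc (k : ℕ) : e (k + 1) + c * ‖x (k + 1) - x k‖ ^ 2 ≤ e k := by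
    have h1 := objective_descent hf_diff hf_conv hf_lip hsup (hx.weights (k + 1))
      (hvi (k + 1) _ (hmem (k + 1)))
    have h2 : (β (k + 1) * ‖x (k + 1) - x k‖) ^ 2 ≤ b ^ 2 * ‖x (k + 1) - x k‖ ^ 2 := by
      rw [mul_pow]
      gcongr
      exacts [(hx.beta_mem _).1, hβ_le _]
    rw [hy] at h1
    have h3 := mul_le_mul_of_nonneg_left h2 (by positivity : (0 : ℝ) ≤ L / 2)
    simp only [he, hc_def, hG]
    linarith
  have hanti : Antitone e := antitone_nat_of_succ_le fun k =>
    (le_add_of_nonneg_right (by positivity)).trans (hdesc k)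
  have hG_le (k : ℕ) : G (x (k + 1)) ≤ e k := le_add_of_nonneg_right (by positivity)
  -- The iterates stay in a sublevel set of the objective, hence in a compact set.
  have hbdd : Bornology.IsBounded {u | objective f C ϕ u ≤ (e 0 : EReal)} := hF (e 0)
  have hlevel (k : ℕ) : x (k + 1) ∈ {u | objective f C ϕ u ≤ (e 0 : EReal)} := by
    rw [mem_ofPred_eq, objective_of_mem (hmem _)]
    exact EReal.coe_le_coe_iff.2 ((hG_le k).trans (hanti (Nat.zero_le k)))
  obtain ⟨p, -, ψ, hψ, hψ_lim⟩ := tendsto_subseq_of_bounded hbdd hlevel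
  have he_bdd : BddBelow (range e) := by
    obtain ⟨m, hm⟩ := (hbdd.isCompact_closure.image hG_cont).bddBelow
    refine ⟨m, ?_⟩
    rintro _ ⟨k, rfl⟩
    exact (hm ⟨_, subset_closure (hlevel k), rfl⟩).trans (hG_le k)
  have he_lim := tendsto_atTop_ciInf hanti he_bdd
  set e₀ := ⨅ k, e k
  have hd : Tendsto (fun k => ‖x (k + 1) - x k‖) atTop (𝓝 0) :=
    tendsto_norm_sub_zero_of_descent hc hdesc he_lim
  have hG_lim : Tendsto (fun k => G (x (k + 1))) atTop (𝓝 e₀) := by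
    have := he_lim.sub ((hd.pow 2).const_mul ((L : ℝ) / 2))
    simpa [he] using this
  have hGp : G p = e₀ := tendsto_nhds_unique ((hG_cont.tendsto p).comp hψ_lim)
    (hG_lim.comp hψ.tendsto_atTop)
  have hpC : p ∈ C := hC_closed.mem_of_tendsto hψ_lim (Eventually.of_forall fun _ => hmem _)
  have hpot_p : potential f C ϕ L (WithLp.toLp 2 (p, p)) = e₀ := by
    rw [potential_of_mem hpC, ← hGp]
    simp [hG]
  have hprox (k : ℕ) := eventually_objective_ge hf_diff hf_conv hsup hlip (hx.weights k) (hvi k)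
  set D : ℝ := 4 * L + ρ with hD_def
  have hD : 0 < D := by positivity
  have hζ_norm (k : ℕ) : ‖stepSubgradient f ϕ L (x (k + 1)) (y (k + 1)) (x (k + 2))‖
      + 2 * (L * ‖x (k + 2) - x (k + 1)‖)
        ≤ D * (‖x (k + 2) - x (k + 1)‖ + ‖x (k + 1) - x k‖) := by
    have h1 := norm_stepSubgradient_le hf_lip hlip (x (k + 1)) (y (k + 1)) (x (k + 2))
    have h2 : ‖x (k + 2) - y (k + 1)‖ ≤ ‖x (k + 2) - x (k + 1)‖ + ‖x (k + 1) - x k‖ := by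
      refine (norm_sub_le_norm_sub_add_norm_sub _ (x (k + 1)) _).trans ?_
      rw [hy]
      gcongr
      exact mul_le_of_le_one_left (norm_nonneg _) (hx.beta_mem _).2.le
    have h3 := mul_le_mul_of_nonneg_left h2 (by positivity : (0 : ℝ) ≤ 2 * L)
    have h4 : 0 ≤ (2 * L + ρ : ℝ) * ‖x (k + 1) - x k‖ := by positivity
    rw [hD_def]
    linarith
  set ξ : ℕ → WithLp 2 (EuclideanSpace ℝ (Fin n) × EuclideanSpace ℝ (Fin n)) := fun k =>
    WithLp.toLp 2 (stepSubgradient f ϕ L (x (k + 1)) (y (k + 1)) (x (k + 2))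
      + (L : ℝ) • (x (k + 2) - x (k + 1)), -((L : ℝ) • (x (k + 2) - x (k + 1))))
  have hξ (k : ℕ) : ξ k ∈ regularSubdifferential (potential f C ϕ L)
      (WithLp.toLp 2 (x (k + 2), x (k + 1))) :=
    mem_regularSubdifferential_potential ρ.2 (hmem _) (hprox (k + 1))
  have hξ_norm (k : ℕ) :
      ‖ξ k‖ ≤ D * (‖x (k + 2) - x (k + 1)‖ + ‖x (k + 1) - x k‖) := by
    refine le_trans ?_ (hζ_norm k)
    have h1 (u v : EuclideanSpace ℝ (Fin n)) : ‖WithLp.toLp 2 (u, v)‖ ≤ ‖u‖ + ‖v‖ := by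
      refine le_of_sq_le_sq ?_ (by positivity)
      rw [WithLp.prod_norm_sq_eq_of_L2]
      simp only [WithLp.toLp_fst, WithLp.toLp_snd]
      nlinarith [mul_nonneg (norm_nonneg u) (norm_nonneg v)]
    refine (h1 _ _).trans ?_
    have h2 := norm_add_le (stepSubgradient f ϕ L (x (k + 1)) (y (k + 1)) (x (k + 2)))
      ((L : ℝ) • (x (k + 2) - x (k + 1)))
    rw [norm_neg]
    rw [norm_smul, Real.norm_of_nonneg L.coe_nonneg] at h2 ⊢
    linarith
  have hbound : Tendsto (fun k => D * (‖x (k + 2) - x (k + 1)‖ + ‖x (k + 1) - x k‖)) atTop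
      (𝓝 0) := by
    simpa using ((hd.comp (tendsto_add_atTop_nat 1)).add hd).const_mul D
  have hψ1 : Tendsto (fun j => x (ψ j + 2)) atTop (𝓝 p) := by
    have h1 := (tendsto_zero_iff_norm_tendsto_zero.2 hd).comp
      ((tendsto_add_atTop_nat 1).comp hψ.tendsto_atTop)
    simpa [Function.comp_def, add_assoc] using h1.add hψ_lim
  have hcrit : (0 : WithLp 2 (EuclideanSpace ℝ (Fin n) × EuclideanSpace ℝ (Fin n))) ∈
      limitingSubdifferential (potential f C ϕ L) (WithLp.toLp 2 (p, p)) := by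
    refine ⟨hpot_p ▸ EReal.coe_lt_top _,
      fun j => WithLp.toLp 2 (x (ψ j + 2), x (ψ j + 1)), fun j => ξ (ψ j), ?_, ?_, ?_,
      fun j => hξ _⟩
    · exact ((WithLp.prod_continuous_toLp 2 _ _).tendsto _).comp (hψ1.prodMk_nhds hψ_lim)
    · rw [hpot_p]
      refine Tendsto.congr (fun j => (he_pot (ψ j + 1)).symm) ?_
      exact (continuous_coe_real_ereal.tendsto _).comp (he_lim.comp
        ((tendsto_add_atTop_nat 1).comp hψ.tendsto_atTop))
    · exact squeeze_zero_norm (fun j => hξ_norm _) (hbound.comp hψ.tendsto_atTop)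
  have hsum : Summable fun k => ‖x (k + 1) - x k‖ :=
    summable_norm_sub_of_hasKLPropertyAt hc hD (hKL.2.2 _ ⟨0, hcrit⟩) hpot_p he_pot hdesc he_lim
      (hψ_lim.mapClusterPt.of_comp ((tendsto_add_atTop_nat 1).comp hψ.tendsto_atTop))
      fun k => ⟨ξ k, regularSubdifferential_subset_limitingSubdifferential _ _ (hξ k), hξ_norm k⟩
  have hx_lim : Tendsto x atTop (𝓝 p) :=
    tendsto_nhds_of_cauchySeq_of_subseq
      (cauchySeq_of_summable_dist (by simpa [dist_eq_norm, norm_sub_rev] using hsum))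
      ((tendsto_add_atTop_nat 1).comp hψ.tendsto_atTop) hψ_lim
  refine ⟨hsum, p, hx_lim, ?_⟩
  refine ⟨objective_of_mem (ϕ := ϕ) (f := f) hpC ▸ EReal.coe_lt_top _, fun k => x (k + 2),
    fun k => stepSubgradient f ϕ L (x (k + 1)) (y (k + 1)) (x (k + 2)),
    hx_lim.comp (tendsto_add_atTop_nat 2), ?_, ?_, fun k =>
      stepSubgradient_mem_regularSubdifferential (hmem _) (hprox (k + 1))⟩
  · rw [objective_of_mem hpC]
    refine Tendsto.congr (fun k => (objective_of_mem (hmem (k + 2))).symm) ?_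
    exact (continuous_coe_real_ereal.tendsto _).comp
      ((hG_cont.tendsto p).comp (hx_lim.comp (tendsto_add_atTop_nat 2)))
  · exact squeeze_zero_norm
      (fun k => (le_add_of_nonneg_right (by positivity)).trans (hζ_norm k)) hbound
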